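/- Let $k\ge 1$ be a fixed integer. For each $n$, choose $k$ total orders $\le_1,\dots,\le_k$ on $\{1,\dots,n\}$ independently and uniformly at random from all $n!$ total orders, and let $P$ be the random $k$-dimensional partial order defined by $x\preceq y$ if and only if $x\le_i y$ for all $1\le i\le k$. Let $C(P)$ be the number of pairwise comparisons needed, in the worst case, to find the true total order given $P$; that is, the least $m$ such that some deterministic adaptive comparison strategy, knowing $P$, correctly identifies every linear extension of $P$ (as the unknown true order) using at most $m$ comparisons. Then, with high probability, $C(P)$ is asymptotically equivalent to $$\frac{n\log_e n}{\log_e 2}\Bigl(1-\frac1k\Bigr).$$ Precisely, for every $\varepsilon>0$, $$\Pr\left[\;\left|C(P)-\frac{n\log_e n}{\log_e 2}\Bigl(1-\frac1k\Bigr)\right|\le \varepsilon\,\frac{n\log_e n}{\log_e 2}\Bigl(1-\frac1k\Bigr)\right]\longrightarrow 1\qquad (n\to\infty).$$ (For $k=1$ this says that $C(P)=0$ with probability tending to $1$.) -/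

import Mathlib

open Filter Topology

noncomputable section

/-- The total (linear) orders `x ≤ y` on the set `α`, as binary relations. -/
def TotalOrder (α : Type*) : Type _ :=
  {r : α → α → Prop // IsLinearOrder α r}

namespace TotalOrder

/-- `L.le x y` says that `x ≤ y` in the total order `L`. -/
def le {α : Type*} (L : TotalOrder α) (x y : α) : Prop := L.1 x y

theorem ext_le {α : Type*} {L M : TotalOrder α} (h : ∀ x y, L.le x y ↔ M.le x y) : L = M :=
  Subtype.ext (funext fun x => funext fun y => propext (h x y))

instance instFinite (α : Type*) [Finite α] : Finite (TotalOrder α) :=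
  inferInstanceAs (Finite {r : α → α → Prop // IsLinearOrder α r})

instance instFintype (α : Type*) [Finite α] : Fintype (TotalOrder α) :=
  Fintype.ofFinite _

instance instNonempty (n : ℕ) : Nonempty (TotalOrder (Fin n)) :=
  ⟨⟨fun x y => x ≤ y, inferInstance⟩⟩

end TotalOrder

/-- The intersection of `k` total orders:
`x ≼ y` if and only if `x ≤ᵢ y` for every one of the `k` orders. -/
def intersectionOrder {α : Type*} {k : ℕ} (o : Fin k → TotalOrder α) (x y : α) : Prop :=
  ∀ i, (o i).le x y

/-- The intersection of at least one total order is a partial order. -/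
theorem intersectionOrder_isPartialOrder {α : Type*} {k : ℕ} (hk : 1 ≤ k)
    (o : Fin k → TotalOrder α) : IsPartialOrder α (intersectionOrder o) := by
  have h := fun i => (o i).2
  exact
    { refl := fun a i => (h i).refl a
      trans := fun a b c hab hbc i => (h i).trans a b c (hab i) (hbc i)
      antisymm := fun a b hab hba => (h ⟨0, hk⟩).antisymm a b (hab _) (hba _) }

/-- The linear extensions of a partial order `P` (given by its relation `≼`). -/
def linearExtensions {α : Type*} (P : α → α → Prop) : Set (TotalOrder α) :=
  {L | ∀ x y, P x y → L.le x y}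

/-- A deterministic adaptive sorting strategy: a binary tree whose inner nodes compare two
elements `x`, `y` (going on with `yes` if `x ≤ y` in the true order and with `no` otherwise) and
whose leaves announce a total order. -/
inductive ComparisonTree (α : Type*) : Type _
  | leaf (answer : TotalOrder α) : ComparisonTree α
  | node (x y : α) (yes no : ComparisonTree α) : ComparisonTree α

namespace ComparisonTree

open Classical in
/-- The total order that the strategy announces if the true order is `L`. -/
def output {α : Type*} : ComparisonTree α → TotalOrder α → TotalOrder α
  | leaf M, _ => M
  | node x y yes no, L => if L.le x y then yes.output L else no.output L

open Classical in
/-- The number of comparisons that the strategy makes if the true order is `L`. -/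
def comparisons {α : Type*} : ComparisonTree α → TotalOrder α → ℕ
  | leaf _, _ => 0
  | node x y yes no, L => (if L.le x y then yes.comparisons L else no.comparisons L) + 1

/-- Given the partial information `P`, the strategy always finds the true order (any linear
extension of `P`), and it makes at most `m` comparisons in the worst case. -/
def SortsWithin {α : Type*} (t : ComparisonTree α) (P : α → α → Prop) (m : ℕ) : Prop :=
  ∀ L ∈ linearExtensions P, t.output L = L ∧ t.comparisons L ≤ m

theorem exists_output_eq {α : Type*} [Finite α] [Nonempty (TotalOrder α)]
    (S : Finset (TotalOrder α)) : ∃ t : ComparisonTree α, ∀ L ∈ S, t.output L = L := by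
  classical
  induction S using Finset.strongInduction with
  | H S ih =>
    by_cases h : ∃ L ∈ S, ∃ M ∈ S, ∃ x y, L.le x y ∧ ¬ M.le x y
    · obtain ⟨L, hL, M, hM, x, y, hx, hy⟩ := h
      obtain ⟨t, ht⟩ := ih (S.filter fun N => N.le x y)
        (Finset.filter_ssubset.2 ⟨M, hM, hy⟩)
      obtain ⟨u, hu⟩ := ih (S.filter fun N => ¬ N.le x y)
        (Finset.filter_ssubset.2 ⟨L, hL, not_not.2 hx⟩)
      refine ⟨node x y t u, fun N hN => ?_⟩
      by_cases hN' : N.le x y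
      · simpa [output, hN'] using ht N (by simp [hN, hN'])
      · simpa [output, hN'] using hu N (by simp [hN, hN'])
    · push Not at h
      obtain rfl | ⟨L, hL⟩ := S.eq_empty_or_nonempty
      · exact ⟨leaf (Classical.arbitrary _), by simp⟩
      · exact ⟨leaf L, fun M hM => TotalOrder.ext_le fun x y =>
          ⟨h L hL M hM x y, h M hM L hL x y⟩⟩

end ComparisonTree

/-- The (worst-case) number of comparisons needed to find the true total order, given the partial
order `P`: the least `m` such that some strategy finds every linear extension of `P` with at most
`m` comparisons. -/
def sortingComplexity {α : Type*} (P : α → α → Prop) : ℕ :=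
  sInf {m | ∃ t : ComparisonTree α, t.SortsWithin P m}

/-- The infimum in `sortingComplexity` is over a non-empty set, hence it is a minimum. -/
theorem exists_sortsWithin_sortingComplexity {n : ℕ} (P : Fin n → Fin n → Prop) :
    ∃ t : ComparisonTree (Fin n), t.SortsWithin P (sortingComplexity P) := by
  have h : {m | ∃ t : ComparisonTree (Fin n), t.SortsWithin P m}.Nonempty := by
    obtain ⟨t, ht⟩ := ComparisonTree.exists_output_eq (Finset.univ : Finset (TotalOrder (Fin n)))
    exact ⟨Finset.univ.sup t.comparisons, t, fun L _ =>
      ⟨ht L (Finset.mem_univ L), Finset.le_sup (f := t.comparisons) (Finset.mem_univ L)⟩⟩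
  exact Nat.sInf_mem h

/-- The law of `k` total orders on an `n`-element set that are chosen independently and uniformly
at random from all total orders; their intersection is the random `k`-dimensional order. -/
def randomTotalOrders (k n : ℕ) : PMF (Fin k → TotalOrder (Fin n)) :=
  PMF.uniformOfFintype (Fin k → TotalOrder (Fin n))

end

/-! Cut each of the `k` orders into blocks of `b ≈ n ^ γ` consecutive elements, with `γ` slightly
below `1 - 1/k`; the block indices of an element form its cell. A given pair shares a cell with
probability at most `(b/n) ^ k`, so the expected number of such pairs is at most `n ^ (2 + (γ - 1) *
k)` up to a constant. This is `o(n)`, and by Markov's inequality almost all elements are alone in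
their cell with high probability (`tendsto_prob_cellPairs`). The rest is deterministic.

Upper bound (`sortingComplexity_le_cellPairs`): distinct cells on a line in direction `(1, ..., 1)`
are comparable in `P`. Once the few pairs within cells have been compared, each of the `O((n/b) ^ (k
- 1))` diagonals is a chain, and merge sort of these chains takes about `(k - 1) * (1 - γ) * n *
log₂ n` comparisons.

Lower bound (`factorial_isolated_le`): distinct cells with the same coordinate sum are incomparable,
so the `N` isolated elements can be permuted freely within the `J = O(n/b)` layers. This yields at
least `N! / J ^ N` linear extensions, and the information bound gives about `γ * n * log₂ n`.

As `γ` tends to `1 - 1/k`, both coefficients tend to `1 - 1/k`. -/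

namespace TotalOrder

variable {α : Type*}

theorem le_rfl' (L : TotalOrder α) (x : α) : L.le x x := L.2.refl x

theorem le_trans' (L : TotalOrder α) {x y z : α} (h : L.le x y) (h' : L.le y z) : L.le x z :=
  L.2.trans x y z h h'

theorem le_antisymm' (L : TotalOrder α) {x y : α} (h : L.le x y) (h' : L.le y x) : x = y :=
  L.2.antisymm x y h h'

theorem le_total' (L : TotalOrder α) (x y : α) : L.le x y ∨ L.le y x :=
  L.2.total x y

theorem exists_least (L : TotalOrder α) {A : Finset α} (hA : A.Nonempty) :
    ∃ a ∈ A, ∀ x ∈ A, L.le a x := by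
  classical
  induction hA using Finset.Nonempty.cons_induction with
  | singleton a => exact ⟨a, by simp, fun x hx => by
      rw [Finset.mem_singleton.1 hx]; exact L.le_rfl' a⟩
  | cons b s hb hs ih =>
    obtain ⟨a, ha, hmin⟩ := ih
    rcases L.le_total' a b with h | h
    · refine ⟨a, Finset.mem_cons_of_mem ha, fun x hx => ?_⟩
      rcases Finset.mem_cons.1 hx with rfl | hx
      exacts [h, hmin x hx]
    · refine ⟨b, Finset.mem_cons_self b s, fun x hx => ?_⟩
      rcases Finset.mem_cons.1 hx with rfl | hx
      exacts [L.le_rfl' _, L.le_trans' h (hmin x hx)]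

end TotalOrder

/-! ### Comparison strategies: merge sort and the information bound -/

section Sorting

variable {α : Type*}

/-- Some strategy finds every order in `S` with at most `m` comparisons. -/
def Solvable (S : Set (TotalOrder α)) (m : ℕ) : Prop :=
  ∃ t : ComparisonTree α, ∀ L ∈ S, t.output L = L ∧ t.comparisons L ≤ m

theorem sortingComplexity_le {P : α → α → Prop} {m : ℕ} (h : Solvable (linearExtensions P) m) :
    sortingComplexity P ≤ m :=
  Nat.sInf_le h

theorem Solvable.mono {S : Set (TotalOrder α)} {m m' : ℕ} (h : Solvable S m) (hm : m ≤ m') :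
    Solvable S m' :=
  let ⟨t, ht⟩ := h
  ⟨t, fun L hL => ⟨(ht L hL).1, (ht L hL).2.trans hm⟩⟩

theorem Solvable.compare {S : Set (TotalOrder α)} {m : ℕ} (x y : α)
    (h₁ : Solvable {L ∈ S | L.le x y} m) (h₂ : Solvable {L ∈ S | ¬ L.le x y} m) :
    Solvable S (m + 1) := by
  obtain ⟨t, ht⟩ := h₁
  obtain ⟨u, hu⟩ := h₂
  refine ⟨.node x y t u, fun L hL => ?_⟩
  by_cases h : L.le x y
  · simpa [ComparisonTree.output, ComparisonTree.comparisons, h] using ht L ⟨hL, h⟩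
  · simpa [ComparisonTree.output, ComparisonTree.comparisons, h] using hu L ⟨hL, h⟩

/-- The orders in `S` coincide on the pairs in `R`. -/
def AgreeOn (S : Set (TotalOrder α)) (R : Set (α × α)) : Prop :=
  ∀ L ∈ S, ∀ M ∈ S, ∀ p ∈ R, L.le p.1 p.2 → M.le p.1 p.2

theorem AgreeOn.subset {S S' : Set (TotalOrder α)} {R : Set (α × α)} (h : AgreeOn S R)
    (hS : S' ⊆ S) : AgreeOn S' R :=
  fun L hL M hM => h L (hS hL) M (hS hM)

/-- With `m` comparisons one can find out how the unknown order in `S` behaves on `R`. -/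
def Reveals (S : Set (TotalOrder α)) (R : Set (α × α)) (m : ℕ) : Prop :=
  ∀ r, (∀ S' ⊆ S, AgreeOn S' R → Solvable S' r) → Solvable S (m + r)

theorem AgreeOn.reveals {S : Set (TotalOrder α)} {R : Set (α × α)} (h : AgreeOn S R) (m : ℕ) :
    Reveals S R m :=
  fun r hr => (hr S subset_rfl h).mono (Nat.le_add_left r m)

theorem reveals_finset (Q : Finset (α × α)) (S : Set (TotalOrder α)) :
    Reveals S (Q : Set (α × α)) Q.card := by
  classical
  induction Q using Finset.induction_on generalizing S with
  | empty => exact AgreeOn.reveals (by simp [AgreeOn]) _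
  | insert p Q hp ih =>
    intro r hr
    rw [Finset.card_insert_of_notMem hp, add_right_comm]
    refine Solvable.compare p.1 p.2 (ih _ r fun S' hS' h => hr S' (hS'.trans fun L hL => hL.1) ?_)
      (ih _ r fun S' hS' h => hr S' (hS'.trans fun L hL => hL.1) ?_)
    · intro L hL M hM q hq
      rcases Finset.mem_insert.1 (Finset.mem_coe.1 hq) with rfl | hq
      exacts [fun _ => (hS' hM).2, h L hL M hM q hq]
    · intro L hL M hM q hq
      rcases Finset.mem_insert.1 (Finset.mem_coe.1 hq) with rfl | hq
      exacts [fun h' => absurd h' (hS' hL).2, h L hL M hM q hq]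

theorem AgreeOn.insert_least {S : Set (TotalOrder α)} {X : Set α} {a : α}
    (h : AgreeOn S (X ×ˢ X)) (ha : ∀ L ∈ S, ∀ x ∈ X, L.le a x) :
    AgreeOn S (insert a X ×ˢ insert a X) := by
  rintro L hL M hM ⟨x, y⟩ ⟨hx, hy⟩ hxy
  simp only [Set.mem_insert_iff] at hx hy hxy ⊢
  rcases hx with rfl | hx
  · rcases hy with rfl | hy
    exacts [M.le_rfl' _, ha M hM y hy]
  · rcases hy with rfl | hy
    · rw [L.le_antisymm' hxy (ha L hL x hx)]
      exact M.le_rfl' _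
    · exact h L hL M hM (x, y) ⟨hx, hy⟩ hxy

/-- Merging two chains: the smaller of the two minima is the minimum of the union, so each
comparison disposes of one element. -/
theorem reveals_union [DecidableEq α] (A B : Finset α) (S : Set (TotalOrder α))
    (hA : AgreeOn S (A ×ˢ A : Set (α × α))) (hB : AgreeOn S (B ×ˢ B : Set (α × α))) :
    Reveals S ((A ∪ B : Finset α) ×ˢ (A ∪ B : Finset α)) (A.card + B.card) := by
  induction hm : A.card + B.card generalizing A B S with
  | zero =>
    obtain ⟨hA', hB'⟩ := Nat.add_eq_zero_iff.1 hm
    rw [Finset.card_eq_zero] at hA' hB'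
    exact AgreeOn.reveals (by simp [AgreeOn, hA', hB']) _
  | succ m ih =>
    obtain rfl | hAne := A.eq_empty_or_nonempty
    · exact AgreeOn.reveals (by simpa using hB) _
    obtain rfl | hBne := B.eq_empty_or_nonempty
    · exact AgreeOn.reveals (by simpa using hA) _
    obtain rfl | ⟨L₀, hL₀⟩ := S.eq_empty_or_nonempty
    · exact AgreeOn.reveals (by simp [AgreeOn]) _
    obtain ⟨a, ha, ha'⟩ := L₀.exists_least hAne
    obtain ⟨b, hb, hb'⟩ := L₀.exists_least hBne
    have hamin : ∀ L ∈ S, ∀ x ∈ A, L.le a x := fun L hL x hx =>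
      hA L₀ hL₀ L hL (a, x) ⟨ha, hx⟩ (ha' x hx)
    have hbmin : ∀ L ∈ S, ∀ x ∈ B, L.le b x := fun L hL x hx =>
      hB L₀ hL₀ L hL (b, x) ⟨hb, hx⟩ (hb' x hx)
    intro r hr
    rw [add_right_comm]
    refine Solvable.compare a b ?_ ?_
    · refine ih (A.erase a) B _ ?_ (hB.subset fun L hL => hL.1) ?_ r fun S' hS' h =>
        hr S' (hS'.trans fun L hL => hL.1) ?_
      · exact fun L hL M hM p hp => hA L hL.1 M hM.1 p
          ⟨Finset.mem_of_mem_erase hp.1, Finset.mem_of_mem_erase hp.2⟩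
      · rw [Finset.card_erase_of_mem ha]
        have := Finset.card_pos.2 hAne
        omega
      · have := h.insert_least (a := a) fun L hL x hx => by
          rcases Finset.mem_union.1 (Finset.mem_coe.1 hx) with hx | hx
          · exact hamin L (hS' hL).1 x (Finset.mem_of_mem_erase hx)
          · exact L.le_trans' (hS' hL).2 (hbmin L (hS' hL).1 x hx)
        rwa [← Finset.coe_insert, ← Finset.insert_union, Finset.insert_erase ha] at this
    · refine ih A (B.erase b) _ (hA.subset fun L hL => hL.1) ?_ ?_ r fun S' hS' h =>
        hr S' (hS'.trans fun L hL => hL.1) ?_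
      · exact fun L hL M hM p hp => hB L hL.1 M hM.1 p
          ⟨Finset.mem_of_mem_erase hp.1, Finset.mem_of_mem_erase hp.2⟩
      · rw [Finset.card_erase_of_mem hb]
        have := Finset.card_pos.2 hBne
        omega
      · have := h.insert_least (a := b) fun L hL x hx => by
          rcases Finset.mem_union.1 (Finset.mem_coe.1 hx) with hx | hx
          · exact L.le_trans' ((L.le_total' a b).resolve_left (hS' hL).2)
              (hamin L (hS' hL).1 x hx)
          · exact hbmin L (hS' hL).1 x (Finset.mem_of_mem_erase hx)
        rwa [← Finset.coe_insert, ← Finset.union_insert, Finset.insert_erase hb] at this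

/-- Merge sort: `2 ^ d` chains can be merged with `d` comparisons per element. -/
theorem reveals_mergeSort [Fintype α] [DecidableEq α] (l : α → ℕ) (d a : ℕ)
    (S : Set (TotalOrder α)) (hS : AgreeOn S {p | l p.1 = l p.2}) :
    Reveals S (({x | a ≤ l x ∧ l x < a + 2 ^ d} : Finset α) ×ˢ
      ({x | a ≤ l x ∧ l x < a + 2 ^ d} : Finset α))
      (d * ({x | a ≤ l x ∧ l x < a + 2 ^ d} : Finset α).card) := by
  induction d generalizing a S with
  | zero =>
    refine AgreeOn.reveals (fun L hL M hM p hp => hS L hL M hM p ?_) _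
    simp only [Set.mem_prod, Finset.mem_coe, Finset.mem_filter, Finset.mem_univ, true_and,
      pow_zero] at hp
    simp only [Set.mem_ofPred_eq]
    omega
  | succ d ih =>
    have hdisj : Disjoint ({x | a ≤ l x ∧ l x < a + 2 ^ d} : Finset α)
        ({x | a + 2 ^ d ≤ l x ∧ l x < a + 2 ^ d + 2 ^ d} : Finset α) := by
      rw [Finset.disjoint_filter]
      intros
      omega
    have hunion : ({x | a ≤ l x ∧ l x < a + 2 ^ (d + 1)} : Finset α) =
        ({x | a ≤ l x ∧ l x < a + 2 ^ d} : Finset α) ∪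
        ({x | a + 2 ^ d ≤ l x ∧ l x < a + 2 ^ d + 2 ^ d} : Finset α) := by
      ext x
      simp only [Finset.mem_filter, Finset.mem_univ, true_and, Finset.mem_union, pow_succ]
      omega
    rw [hunion, Finset.card_union_of_disjoint hdisj]
    intro r hr
    -- The continuation form of `Reveals` lets the three phases (lower labels, upper labels,
    -- merging) be nested, so that their costs add up.
    have key := ih a S hS _ fun S₁ hS₁ h₁ => ih (a + 2 ^ d) S₁ (hS.subset hS₁) _ fun S₂ hS₂ h₂ =>
      reveals_union _ _ S₂ (h₁.subset hS₂) h₂ r fun S₃ hS₃ h₃ =>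
        hr S₃ (hS₃.trans (hS₂.trans hS₁)) h₃
    refine key.mono (le_of_eq ?_)
    ring

/-- After the pairs in `Q` have been compared, every label class is a chain whose order is known,
and merge sort takes over. -/
theorem sortingComplexity_le_of_labels [Fintype α] [Nonempty (TotalOrder α)]
    {P : α → α → Prop} (l : α → ℕ) (d : ℕ) (hl : ∀ x, l x < 2 ^ d) (Q : Finset (α × α))
    (hQ : ∀ x y, l x = l y → (x, y) ∈ Q ∨ P x y ∨ P y x) :
    sortingComplexity P ≤ Q.card + d * Fintype.card α := by
  classical
  refine sortingComplexity_le (reveals_finset Q _ _ fun S hS h => ?_)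
  have huniv : ({x | 0 ≤ l x ∧ l x < 0 + 2 ^ d} : Finset α) = Finset.univ :=
    Finset.filter_true_of_mem fun x _ => by simpa using hl x
  have key := reveals_mergeSort l d 0 S (fun L hL M hM p hp hLp => by
    rcases hQ p.1 p.2 hp with hp | hp | hp
    · exact h L hL M hM p hp hLp
    · exact hS hM _ _ hp
    · rw [L.le_antisymm' hLp (hS hL _ _ hp)]
      exact M.le_rfl' _) 0
  rw [huniv, Finset.card_univ] at key
  refine key fun S' hS' h' => ?_
  obtain rfl | ⟨L, hL⟩ := S'.eq_empty_or_nonempty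
  · exact ⟨.leaf (Classical.arbitrary _), by simp⟩
  · exact ⟨.leaf L, fun M hM => ⟨TotalOrder.ext_le fun x y =>
      ⟨h' L hL M hM (x, y) (by simp), h' M hM L hL (x, y) (by simp)⟩, le_rfl⟩⟩

/-- Information bound: different orders must end in different leaves, and depth `m` allows at most
`2 ^ m` leaves. -/
theorem ComparisonTree.card_le_two_pow (t : ComparisonTree α) (S : Finset (TotalOrder α)) (m : ℕ)
    (h : ∀ L ∈ S, t.output L = L ∧ t.comparisons L ≤ m) : S.card ≤ 2 ^ m := by
  classical
  induction t generalizing S m with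
  | leaf M =>
    refine (Finset.card_le_card (t := {M}) fun L hL => ?_).trans (by simpa using Nat.one_le_two_pow)
    simpa [output] using (h L hL).1.symm
  | node x y t u iht ihu =>
    obtain rfl | ⟨L₀, hL₀⟩ := S.eq_empty_or_nonempty
    · simp
    obtain ⟨m, rfl⟩ : ∃ m', m = m' + 1 := by
      have := (h L₀ hL₀).2
      simp only [comparisons] at this
      exact ⟨m - 1, by omega⟩
    rw [← Finset.card_filter_add_card_filter_not (s := S) (fun L => L.le x y), pow_succ, mul_two]
    refine add_le_add (iht _ m fun L hL => ?_) (ihu _ m fun L hL => ?_)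
    · rw [Finset.mem_filter] at hL
      simpa [output, comparisons, hL.2] using h L hL.1
    · rw [Finset.mem_filter] at hL
      simpa [output, comparisons, hL.2] using h L hL.1

theorem card_le_two_pow_sortingComplexity {n : ℕ} (P : Fin n → Fin n → Prop)
    (S : Finset (TotalOrder (Fin n))) (hS : ∀ L ∈ S, L ∈ linearExtensions P) :
    S.card ≤ 2 ^ sortingComplexity P := by
  obtain ⟨t, ht⟩ := exists_sortsWithin_sortingComplexity P
  exact t.card_le_two_pow S _ fun L hL => ht L (hS L hL)

end Sorting

/-! ### Ranks, relabelling and blocks -/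

open Classical in
/-- The number of elements strictly below `x` in the total order `L`. -/
noncomputable def TotalOrder.rank {α : Type*} [Fintype α] (L : TotalOrder α) (x : α) : ℕ :=
  ({y | y ≠ x ∧ L.le y x} : Finset α).card

/-- The total order in which `x ≤ y` if and only if `e x ≤ e y` in the given one. -/
def TotalOrder.comap {α β : Type*} (e : α → β) (he : Function.Injective e) (L : TotalOrder β) :
    TotalOrder α :=
  ⟨fun x y => L.le (e x) (e y),
    { refl := fun x => L.le_rfl' (e x)
      trans := fun _ _ _ => L.le_trans'
      antisymm := fun _ _ h h' => he (L.le_antisymm' h h')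
      total := fun x y => L.le_total' (e x) (e y) }⟩

/-- The total order given by a linear order. -/
def TotalOrder.ofLinearOrder (β : Type*) [LinearOrder β] : TotalOrder β :=
  ⟨fun x y => x ≤ y, inferInstance⟩

namespace TotalOrder

variable {α : Type*}

@[simp]
theorem comap_le {β : Type*} (e : α → β) (he : Function.Injective e) (L : TotalOrder β) (x y : α) :
    (L.comap e he).le x y ↔ L.le (e x) (e y) :=
  Iff.rfl

@[simp]
theorem ofLinearOrder_le {β : Type*} [LinearOrder β] (x y : β) :
    (ofLinearOrder β).le x y ↔ x ≤ y :=
  Iff.rfl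

/-- A permutation of the elements permutes the total orders. -/
def relabel (e : Equiv.Perm α) : Equiv.Perm (TotalOrder α) where
  toFun := comap e e.injective
  invFun := comap e.symm e.symm.injective
  left_inv L := ext_le fun x y => by simp
  right_inv L := ext_le fun x y => by simp

@[simp]
theorem relabel_le (e : Equiv.Perm α) (L : TotalOrder α) (x y : α) :
    (relabel e L).le x y ↔ L.le (e x) (e y) :=
  Iff.rfl

variable [Fintype α]

theorem rank_lt_rank (L : TotalOrder α) {x y : α} (h : L.le x y) (hne : x ≠ y) :
    L.rank x < L.rank y := by
  classical
  refine Finset.card_lt_card ⟨fun z hz => ?_, fun hsub => ?_⟩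
  · simp only [Finset.mem_filter, Finset.mem_univ, true_and] at hz ⊢
    refine ⟨?_, L.le_trans' hz.2 h⟩
    rintro rfl
    exact hne (L.le_antisymm' h hz.2)
  · have := hsub (show x ∈ _ by simpa using ⟨hne, h⟩)
    simp at this

theorem rank_le_rank (L : TotalOrder α) {x y : α} (h : L.le x y) : L.rank x ≤ L.rank y := by
  obtain rfl | hne := eq_or_ne x y
  exacts [le_rfl, (L.rank_lt_rank h hne).le]

theorem le_of_rank_lt (L : TotalOrder α) {x y : α} (h : L.rank x < L.rank y) : L.le x y :=
  (L.le_total' x y).resolve_right fun h' => (L.rank_le_rank h').not_gt h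

theorem rank_injective (L : TotalOrder α) : Function.Injective L.rank := by
  intro x y h
  by_contra hne
  rcases L.le_total' x y with h' | h'
  · exact (L.rank_lt_rank h' hne).ne h
  · exact (L.rank_lt_rank h' (Ne.symm hne)).ne h.symm

theorem rank_lt_card (L : TotalOrder α) (x : α) : L.rank x < Fintype.card α := by
  classical
  exact Finset.card_lt_univ_of_notMem (x := x) (by simp)

theorem rank_div_le (L : TotalOrder α) (b : ℕ) (x : α) : L.rank x / b ≤ Fintype.card α / b :=
  Nat.div_le_div_right (L.rank_lt_card x).le

theorem rank_relabel (e : Equiv.Perm α) (L : TotalOrder α) (x : α) :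
    (relabel e L).rank x = L.rank (e x) := by
  classical
  refine Finset.card_equiv e fun y => ?_
  simp

theorem relabel_left_injective (L : TotalOrder α) :
    Function.Injective fun e : Equiv.Perm α => relabel e L := by
  intro e f h
  ext x
  have h' := congrArg (fun M : TotalOrder α => M.rank x) h
  simp only [rank_relabel] at h'
  exact L.rank_injective h'

open Classical in
theorem card_same_block_le (L : TotalOrder α) {b : ℕ} (hb : 0 < b) (x : α) :
    ({y | y ≠ x ∧ L.rank x / b = L.rank y / b} : Finset α).card ≤ b - 1 := by
  have h : (({y | y ≠ x ∧ L.rank x / b = L.rank y / b} : Finset α).image L.rank) ⊆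
      (Finset.Ico (L.rank x / b * b) (L.rank x / b * b + b)).erase (L.rank x) := by
    intro v hv
    simp only [Finset.mem_image, Finset.mem_filter, Finset.mem_univ, true_and] at hv
    obtain ⟨y, ⟨hne, hy⟩, rfl⟩ := hv
    rw [Finset.mem_erase, Finset.mem_Ico, hy]
    exact ⟨fun h => hne (L.rank_injective h), Nat.div_mul_le_self _ _,
      Nat.lt_div_mul_add hb⟩
  have h' := Finset.card_le_card h
  rw [Finset.card_image_of_injective _ L.rank_injective, Finset.card_erase_of_mem,
    Nat.card_Ico] at h'
  · omega
  · rw [Finset.mem_Ico]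
    exact ⟨Nat.div_mul_le_self _ _, Nat.lt_div_mul_add hb⟩

open Classical in
theorem card_orders_same_block_congr (b : ℕ) {x y z : α} (hy : y ≠ x) (hz : z ≠ x) :
    ({L | L.rank x / b = L.rank y / b} : Finset (TotalOrder α)).card =
      ({L | L.rank x / b = L.rank z / b} : Finset (TotalOrder α)).card := by
  refine Finset.card_equiv (relabel (Equiv.swap y z)) fun L => ?_
  simp only [Finset.mem_filter, Finset.mem_univ, true_and, rank_relabel,
    Equiv.swap_apply_of_ne_of_ne hy.symm hz.symm, Equiv.swap_apply_right]

open Classical in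
-- By symmetry every `z ≠ x` is equally likely to share the block of `x`, and at most `b - 1` of
-- them do so; hence the probability is at most `(b - 1) / (n - 1)`.
theorem card_orders_same_block_le {b : ℕ} (hb : 0 < b) {x y : α} (hy : y ≠ x) :
    (Fintype.card α - 1) * ({L | L.rank x / b = L.rank y / b} : Finset (TotalOrder α)).card ≤
      Fintype.card (TotalOrder α) * (b - 1) := by
  calc _ = ∑ z ∈ Finset.univ.erase x,
        ({L | L.rank x / b = L.rank z / b} : Finset (TotalOrder α)).card := by
        rw [Finset.sum_congr rfl fun z hz =>
          card_orders_same_block_congr b (Finset.ne_of_mem_erase hz) hy, Finset.sum_const,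
          Finset.card_erase_of_mem (Finset.mem_univ x), Finset.card_univ, smul_eq_mul]
    _ = ∑ L : TotalOrder α, ({z | z ≠ x ∧ L.rank x / b = L.rank z / b} : Finset α).card := by
        simp only [Finset.card_filter]
        rw [Finset.sum_comm]
        refine Finset.sum_congr rfl fun L _ => ?_
        rw [← Finset.filter_ne', Finset.sum_filter]
        refine Finset.sum_congr rfl fun z _ => ?_
        by_cases hz : z = x <;> simp [hz]
    _ ≤ _ := by
        refine (Finset.sum_le_card_nsmul _ _ (b - 1) fun L _ => L.card_same_block_le hb x).trans ?_
        rw [Finset.card_univ, smul_eq_mul]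

end TotalOrder

/-! ### Cells, and the upper bound by diagonals -/

section Cells

variable {α : Type*} [Fintype α] {k : ℕ}

/-- The cell of `x`: each of the orders is cut into blocks of `b` consecutive elements. -/
noncomputable def cell (b : ℕ) (o : Fin k → TotalOrder α) (x : α) (i : Fin k) : ℕ :=
  (o i).rank x / b

open Classical in
/-- The ordered pairs of distinct elements in the same cell. -/
noncomputable def cellPairs (b : ℕ) (o : Fin k → TotalOrder α) : Finset (α × α) :=
  {p | p.2 ≠ p.1 ∧ ∀ i, cell b o p.1 i = cell b o p.2 i}

open Classical in
theorem sum_card_cellPairs (b : ℕ) :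
    ∑ o : Fin k → TotalOrder α, (cellPairs b o).card =
      ∑ p : α × α with p.2 ≠ p.1,
        ({L | L.rank p.1 / b = L.rank p.2 / b} : Finset (TotalOrder α)).card ^ k := by
  have h (p : α × α) : ({L | L.rank p.1 / b = L.rank p.2 / b} : Finset (TotalOrder α)).card ^ k =
      ∑ o : Fin k → TotalOrder α, if ∀ i, cell b o p.1 i = cell b o p.2 i then 1 else 0 := by
    have hpi : ({o | ∀ i, cell b o p.1 i = cell b o p.2 i} : Finset (Fin k → TotalOrder α)) =
        Fintype.piFinset fun _ => {L | L.rank p.1 / b = L.rank p.2 / b} := by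
      ext o
      simp only [Finset.mem_filter, Fintype.mem_piFinset, Finset.mem_univ, true_and]
      rfl
    rw [← Finset.card_filter, hpi, Fintype.card_piFinset_const]
  simp only [h]
  rw [Finset.sum_comm]
  refine Finset.sum_congr rfl fun o _ => ?_
  rw [cellPairs, ← Finset.filter_filter, Finset.card_filter]

theorem sum_card_cellPairs_le {b : ℕ} (hb : 0 < b) (hbn : b ≤ Fintype.card α) :
    ∑ o : Fin k → TotalOrder α, ((cellPairs b o).card : ℝ) ≤
      (Fintype.card α : ℝ) ^ 2 * (b / Fintype.card α : ℝ) ^ k *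
        Fintype.card (Fin k → TotalOrder α) := by
  classical
  have hn : (0 : ℝ) < Fintype.card α := by exact_mod_cast hb.trans_le hbn
  rw [← Nat.cast_sum, sum_card_cellPairs]
  push_cast
  have key : ∀ p ∈ ({p | p.2 ≠ p.1} : Finset (α × α)),
      ((({L | L.rank p.1 / b = L.rank p.2 / b} : Finset (TotalOrder α)).card : ℝ)) ^ k ≤
        (b / Fintype.card α * Fintype.card (TotalOrder α) : ℝ) ^ k := by
    intro p hp
    have hp := (Finset.mem_filter.1 hp).2
    refine pow_le_pow_left₀ (Nat.cast_nonneg _) ?_ k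
    have h := TotalOrder.card_orders_same_block_le hb hp
    have h1 : 1 < Fintype.card α := Fintype.one_lt_card_iff.2 ⟨_, _, hp⟩
    have h' : ((Fintype.card α : ℝ) - 1) *
        (({L | L.rank p.1 / b = L.rank p.2 / b} : Finset (TotalOrder α)).card : ℝ) ≤
        Fintype.card (TotalOrder α) * ((b : ℝ) - 1) := by
      have := (Nat.cast_le (α := ℝ)).2 h
      push_cast [Nat.cast_sub h1.le, Nat.cast_sub (show 1 ≤ b from hb)] at this
      exact this
    have h1' : (1 : ℝ) < Fintype.card α := by exact_mod_cast h1
    have hbn' : (b : ℝ) ≤ Fintype.card α := by exact_mod_cast hbn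
    rw [div_mul_eq_mul_div, le_div_iff₀ hn]
    have hT : (0 : ℝ) ≤ Fintype.card (TotalOrder α) := Nat.cast_nonneg _
    generalize (Fintype.card α : ℝ) = n at *
    generalize (Fintype.card (TotalOrder α) : ℝ) = T at *
    generalize ((Finset.card _ : ℕ) : ℝ) = q at *
    -- This is `(b - 1) / (n - 1) ≤ b / n`, which holds because `b ≤ n`.
    refine le_of_mul_le_mul_left ?_ (sub_pos.2 h1')
    nlinarith [mul_le_mul_of_nonneg_right h' hn.le, mul_nonneg hT (sub_nonneg.2 hbn')]
  refine (Finset.sum_le_card_nsmul _ _ _ key).trans ?_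
  rw [nsmul_eq_mul, mul_pow, Fintype.card_fun, Fintype.card_fin, Nat.cast_pow, ← mul_assoc]
  refine mul_le_mul_of_nonneg_right (mul_le_mul_of_nonneg_right ?_ (by positivity))
    (by positivity)
  rw [sq, ← Nat.cast_mul, ← Fintype.card_prod, ← Finset.card_univ]
  exact_mod_cast Finset.card_filter_le _ _

theorem sortingComplexity_le_cellPairs [Nonempty (TotalOrder α)] (b : ℕ)
    (o : Fin (k + 1) → TotalOrder α) :
    sortingComplexity (intersectionOrder o) ≤ (cellPairs b o).card +
      Nat.clog 2 ((2 * (Fintype.card α / b + 1)) ^ k) * Fintype.card α := by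
  classical
  set M := Fintype.card α / b + 1 with hM
  have hlt (x : α) (i) : cell b o x i < M := Nat.lt_succ_of_le ((o i).rank_div_le b x)
  -- The label names the diagonal of the cell: the differences to coordinate `0`, shifted by `M` to
  -- avoid truncated subtraction. The `k + 1` orders leave only `k` differences, which is where the
  -- factor `1 - 1/(k + 1)` comes from.
  let lab (x : α) : Fin k → Fin (2 * M) := fun j =>
    ⟨cell b o x j.succ + M - cell b o x 0, by have := hlt x j.succ; have := hlt x 0; omega⟩
  let e := Fintype.equivFin (Fin k → Fin (2 * M))
  have hle {x y : α} (hxy : lab x = lab y) (h : cell b o x 0 < cell b o y 0) :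
      intersectionOrder o x y := by
    intro i
    refine (o i).le_of_rank_lt (Nat.lt_of_div_lt_div (c := b) ?_)
    change cell b o x i < cell b o y i
    refine Fin.cases h (fun j => ?_) i
    have := Fin.ext_iff.1 (congrFun hxy j)
    simp only [lab] at this
    have := hlt x 0
    have := hlt y 0
    omega
  refine sortingComplexity_le_of_labels (fun x => (e (lab x) : ℕ)) _ (fun x => ?_)
    (cellPairs b o) fun x y hxy => ?_
  · refine (e (lab x)).2.trans_le ?_
    rw [Fintype.card_fun, Fintype.card_fin, Fintype.card_fin]
    exact Nat.le_pow_clog one_lt_two _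
  · have hxy : lab x = lab y := e.injective (Fin.ext hxy)
    rcases lt_trichotomy (cell b o x 0) (cell b o y 0) with h | h | h
    · exact Or.inr (Or.inl (hle hxy h))
    · obtain rfl | hne := eq_or_ne y x
      · exact Or.inr (Or.inl fun i => (o i).le_rfl' _)
      refine Or.inl (Finset.mem_filter.2 ⟨Finset.mem_univ _, hne, fun i => ?_⟩)
      refine Fin.cases h (fun j => ?_) i
      change cell b o x j.succ = cell b o y j.succ
      have := Fin.ext_iff.1 (congrFun hxy j)
      simp only [lab] at this
      have := hlt x 0
      have := hlt y 0
      omega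
    · exact Or.inr (Or.inr (hle hxy.symm h))

end Cells

/-! ### The lower bound by layers -/

open Classical in
-- Orbit counting: the colouring `f` has at most `J ^ Fintype.card β` images `f ∘ τ`, and each is
-- attained by at most as many `τ` as there are in the stabilizer.
theorem factorial_card_le_card_stabilizer_mul {β : Type*} [Fintype β] {J : ℕ} (f : β → Fin J) :
    (Fintype.card β).factorial ≤
      ({τ | ∀ x, f (τ x) = f x} : Finset (Equiv.Perm β)).card * J ^ Fintype.card β := by
  have h := Finset.card_le_mul_card_image (f := fun (τ : Equiv.Perm β) x => f (τ x)) Finset.univ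
    ({τ | ∀ x, f (τ x) = f x} : Finset (Equiv.Perm β)).card fun g hg => by
      obtain ⟨τ₀, -, rfl⟩ := Finset.mem_image.1 hg
      refine Finset.card_le_card_of_injOn (fun τ => τ * τ₀⁻¹) (fun τ hτ => ?_)
        (mul_left_injective _).injOn
      simp only [Finset.coe_filter, Finset.mem_univ, true_and] at hτ ⊢
      intro x
      simpa using congrFun hτ (τ₀⁻¹ x)
  rw [Finset.card_univ, Fintype.card_perm] at h
  refine h.trans (Nat.mul_le_mul_left _ ((Finset.card_le_univ _).trans (le_of_eq ?_)))
  rw [Fintype.card_fun, Fintype.card_fin]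

section Layers

variable {α : Type*} [Fintype α] {k : ℕ}

open Classical in
/-- The elements that are alone in their cell. -/
noncomputable def isolated (b : ℕ) (o : Fin k → TotalOrder α) : Finset α :=
  {x | ∀ y, y ≠ x → ∃ i, cell b o x i ≠ cell b o y i}

theorem mem_isolated {b : ℕ} {o : Fin k → TotalOrder α} {x : α} :
    x ∈ isolated b o ↔ ∀ y, y ≠ x → ∃ i, cell b o x i ≠ cell b o y i := by
  simp [isolated]

theorem card_le_isolated_add_cellPairs (b : ℕ) (o : Fin k → TotalOrder α) :
    Fintype.card α ≤ (isolated b o).card + (cellPairs b o).card := by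
  classical
  have h : (Finset.univ : Finset α) ⊆ isolated b o ∪ (cellPairs b o).image Prod.fst := by
    intro x _
    by_cases hx : x ∈ isolated b o
    · exact Finset.mem_union_left _ hx
    · rw [mem_isolated] at hx
      push Not at hx
      obtain ⟨y, hne, hy⟩ := hx
      exact Finset.mem_union_right _ (Finset.mem_image.2
        ⟨(x, y), Finset.mem_filter.2 ⟨Finset.mem_univ _, hne, hy⟩, rfl⟩)
  exact (Finset.card_le_card h).trans ((Finset.card_union_le _ _).trans
    (Nat.add_le_add_left Finset.card_image_le _))

/-- The layer of `x`: the sum of the coordinates of its cell. -/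
noncomputable def layer (b : ℕ) (o : Fin k → TotalOrder α) (x : α) : ℕ :=
  ∑ i, cell b o x i

theorem layer_lt (b : ℕ) (o : Fin k → TotalOrder α) (x : α) :
    layer b o x < k * (Fintype.card α / b) + 1 := by
  refine Nat.lt_succ_of_le ((Finset.sum_le_card_nsmul _ _ _ fun i _ =>
    (o i).rank_div_le b x).trans ?_)
  simp

open Classical in
/-- Elements are compared by their layer, then by whether they are isolated, then by the first of
the given orders. -/
noncomputable def layerKey (b : ℕ) (o : Fin (k + 1) → TotalOrder α) (x : α) : ℕ ×ₗ (ℕ ×ₗ ℕ) :=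
  toLex (layer b o x, toLex (if x ∈ isolated b o then 1 else 0, (o 0).rank x))

theorem layerKey_injective (b : ℕ) (o : Fin (k + 1) → TotalOrder α) :
    Function.Injective (layerKey b o) := by
  intro x y h
  simp only [layerKey, EmbeddingLike.apply_eq_iff_eq, Prod.mk.injEq] at h
  exact (o 0).rank_injective h.2.2

/-- If `x ≼ y`, then the cell of `x` is coordinatewise at most that of `y`. Either the layer
increases strictly, and `τ` preserves layers, or the cells coincide; then neither element is
isolated and `τ` fixes both. -/
theorem relabel_mem_linearExtensions [DecidableEq α] (b : ℕ) (o : Fin (k + 1) → TotalOrder α)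
    (τ : Equiv.Perm (isolated b o)) (hτ : ∀ x, layer b o (τ x) = layer b o x) :
    TotalOrder.relabel (Equiv.Perm.ofSubtype τ)
        ((TotalOrder.ofLinearOrder _).comap (layerKey b o) (layerKey_injective b o)) ∈
      linearExtensions (intersectionOrder o) := by
  have hlay (x : α) : layer b o (Equiv.Perm.ofSubtype τ x) = layer b o x := by
    by_cases hx : x ∈ isolated b o
    · rw [Equiv.Perm.ofSubtype_apply_of_mem τ hx, hτ]
    · rw [Equiv.Perm.ofSubtype_apply_of_not_mem τ hx]
  intro x y hxy
  simp only [TotalOrder.relabel_le, TotalOrder.comap_le, TotalOrder.ofLinearOrder_le]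
  obtain rfl | hne := eq_or_ne y x
  · exact le_rfl
  have hcell (i) : cell b o x i ≤ cell b o y i :=
    Nat.div_le_div_right ((o i).rank_le_rank (hxy i))
  rcases (Finset.sum_le_sum fun i _ => hcell i : layer b o x ≤ layer b o y).lt_or_eq with h | h
  · refine Prod.Lex.toLex_le_toLex.2 (Or.inl ?_)
    change layer b o _ < layer b o _
    rwa [hlay, hlay]
  · have hcell' (i) : cell b o x i = cell b o y i :=
      (Finset.sum_eq_sum_iff_of_le fun i _ => hcell i).1 h i (Finset.mem_univ i)
    have hx : x ∉ isolated b o := fun hx => by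
      obtain ⟨i, hi⟩ := mem_isolated.1 hx y hne
      exact hi (hcell' i)
    have hy : y ∉ isolated b o := fun hy => by
      obtain ⟨i, hi⟩ := mem_isolated.1 hy x hne.symm
      exact hi (hcell' i).symm
    rw [Equiv.Perm.ofSubtype_apply_of_not_mem τ hx, Equiv.Perm.ofSubtype_apply_of_not_mem τ hy]
    refine Prod.Lex.toLex_le_toLex.2 (Or.inr ⟨h, Prod.Lex.toLex_le_toLex.2 (Or.inr ⟨?_, ?_⟩)⟩)
    · simp [hx, hy]
    · exact (o 0).rank_le_rank (hxy 0)

theorem factorial_isolated_le {n : ℕ} (b : ℕ) (o : Fin (k + 1) → TotalOrder (Fin n)) :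
    (isolated b o).card.factorial ≤ 2 ^ sortingComplexity (intersectionOrder o) *
      ((k + 1) * (n / b) + 1) ^ (isolated b o).card := by
  classical
  let f (x : isolated b o) : Fin ((k + 1) * (n / b) + 1) :=
    ⟨layer b o x, by simpa using layer_lt b o (x : Fin n)⟩
  have h := factorial_card_le_card_stabilizer_mul f
  rw [Fintype.card_coe] at h
  refine h.trans (Nat.mul_le_mul_right _ ?_)
  let F (τ : Equiv.Perm (isolated b o)) : TotalOrder (Fin n) :=
    TotalOrder.relabel (Equiv.Perm.ofSubtype τ)
      ((TotalOrder.ofLinearOrder _).comap (layerKey b o) (layerKey_injective b o))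
  have hF : Function.Injective F :=
    (TotalOrder.relabel_left_injective _).comp Equiv.Perm.ofSubtype_injective
  rw [← Finset.card_image_of_injective _ hF]
  refine card_le_two_pow_sortingComplexity _ _ fun L hL => ?_
  obtain ⟨τ, hτ, rfl⟩ := Finset.mem_image.1 hL
  exact relabel_mem_linearExtensions b o τ fun x =>
    congrArg Fin.val ((Finset.mem_filter.1 hτ).2 x)

end Layers

/-! ### Estimates for blocks of length `⌈n ^ γ⌉` -/

section Asymptotics

variable {k n : ℕ}

theorem div_ceil_rpow_le (hn : 1 ≤ n) (γ : ℝ) :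
    ((n / ⌈(n : ℝ) ^ γ⌉₊ : ℕ) : ℝ) ≤ (n : ℝ) ^ (1 - γ) := by
  have hn' : (0 : ℝ) < n := by exact_mod_cast hn
  refine Nat.cast_div_le.trans ?_
  rw [Real.rpow_sub hn', Real.rpow_one]
  exact div_le_div_of_nonneg_left hn'.le (Real.rpow_pos_of_pos hn' γ) (Nat.le_ceil _)

theorem sortingComplexity_upper (hn : 1 ≤ n) {γ : ℝ} (hγ : γ ≤ 1)
    (o : Fin (k + 1) → TotalOrder (Fin n)) :
    (sortingComplexity (intersectionOrder o) : ℝ) ≤ (cellPairs ⌈(n : ℝ) ^ γ⌉₊ o).card +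
      (k * (2 + (1 - γ) * (Real.log n / Real.log 2)) + 1) * n := by
  have hn' : (1 : ℝ) ≤ n := by exact_mod_cast hn
  have hlog2 : 0 < Real.log 2 := Real.log_pos one_lt_two
  have h := (Nat.cast_le (α := ℝ)).2 (sortingComplexity_le_cellPairs ⌈(n : ℝ) ^ γ⌉₊ o)
  push_cast [Fintype.card_fin] at h
  refine h.trans (add_le_add_right (mul_le_mul_of_nonneg_right ?_ (Nat.cast_nonneg n)) _)
  set M := n / ⌈(n : ℝ) ^ γ⌉₊ + 1 with hM
  have h1 : (1 : ℝ) ≤ (n : ℝ) ^ (1 - γ) := Real.one_le_rpow hn' (by linarith)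
  -- The factor `4` becomes the summand `2 = log₂ 4` per coordinate; the final `+ 1` in the bound
  -- pays for the rounding in `Nat.clog`.
  have hMle : (2 * M : ℝ) ≤ 4 * (n : ℝ) ^ (1 - γ) := by
    have := div_ceil_rpow_le hn γ
    rw [hM]
    push_cast
    linarith
  have hMpos : (0 : ℝ) < 2 * M := by rw [hM]; positivity
  have hlogM : Real.logb 2 ((2 * M : ℝ) ^ k) ≤
      k * (2 + (1 - γ) * (Real.log n / Real.log 2)) := by
    rw [Real.logb_pow]
    refine mul_le_mul_of_nonneg_left ?_ (Nat.cast_nonneg k)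
    refine (Real.logb_le_logb_of_le one_lt_two hMpos hMle).trans (le_of_eq ?_)
    rw [Real.logb_mul (by norm_num) (by positivity), Real.logb_rpow_eq_mul_logb_of_pos (by linarith),
      Real.log_div_log, show (4 : ℝ) = 2 ^ (2 : ℝ) by norm_num,
      Real.logb_rpow (by norm_num) (by norm_num)]
  have hceil : (Nat.clog 2 ((2 * M) ^ k) : ℝ) ≤ Real.logb 2 ((2 * M : ℝ) ^ k) + 1 := by
    rw [← Real.natCeil_logb_natCast]
    push_cast
    refine (Nat.ceil_lt_add_one (Real.logb_nonneg one_lt_two ?_)).le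
    refine one_le_pow₀ ?_
    have : (1 : ℝ) ≤ M := by rw [hM]; push_cast; linarith [Nat.cast_nonneg (α := ℝ) (n / ⌈(n : ℝ) ^ γ⌉₊)]
    linarith
  linarith

theorem mul_log_sub_le_log_factorial {N : ℕ} (hN : 0 < N) :
    N * (Real.log N - 1) ≤ Real.log N.factorial := by
  have hN' : (0 : ℝ) < N := by exact_mod_cast hN
  have h := Real.pow_div_factorial_le_exp (N : ℝ) hN'.le N
  have h' := Real.log_le_log (by positivity) h
  rw [Real.log_div (by positivity) (by positivity), Real.log_pow, Real.log_exp] at h'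
  linarith

theorem sortingComplexity_lower (hn : 1 ≤ n) {γ δ : ℝ} (hγ : γ ≤ 1) (hδ : δ < 1)
    (hlarge : 1 + Real.log (2 * (k + 1)) - Real.log (1 - δ) ≤ γ * Real.log n)
    (o : Fin (k + 1) → TotalOrder (Fin n))
    (ho : ((cellPairs ⌈(n : ℝ) ^ γ⌉₊ o).card : ℝ) ≤ δ * n) :
    (1 - δ) * n * (γ * Real.log n - (1 + Real.log (2 * (k + 1)) - Real.log (1 - δ))) ≤
      sortingComplexity (intersectionOrder o) * Real.log 2 := by
  have hn' : (1 : ℝ) ≤ n := by exact_mod_cast hn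
  set b := ⌈(n : ℝ) ^ γ⌉₊ with hb
  set N := (isolated b o).card with hN
  have hNn : (1 - δ) * n ≤ N := by
    have := (Nat.cast_le (α := ℝ)).2 (card_le_isolated_add_cellPairs b o)
    push_cast [Fintype.card_fin] at this
    linarith
  have hpos : 0 < (1 - δ) * n := mul_pos (by linarith) (by linarith)
  have hN0 : (0 : ℝ) < N := hpos.trans_le hNn
  set J := (k + 1) * (n / b) + 1 with hJ
  have hJ0 : (0 : ℝ) < J := by rw [hJ]; positivity
  have h1 : (1 : ℝ) ≤ (n : ℝ) ^ (1 - γ) := Real.one_le_rpow hn' (by linarith)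
  have hJle : (J : ℝ) ≤ 2 * (k + 1) * (n : ℝ) ^ (1 - γ) := by
    have hdiv := mul_le_mul_of_nonneg_left (div_ceil_rpow_le hn γ)
      (show (0 : ℝ) ≤ k + 1 by positivity)
    have hk : (1 : ℝ) ≤ k + 1 := by linarith [Nat.cast_nonneg (α := ℝ) k]
    have := one_le_mul_of_one_le_of_one_le hk h1
    rw [hJ]
    push_cast
    linarith
  have hlogJ : Real.log J ≤ Real.log (2 * (k + 1)) + (1 - γ) * Real.log n := by
    refine (Real.log_le_log hJ0 hJle).trans (le_of_eq ?_)
    rw [Real.log_mul (by positivity) (by positivity), Real.log_rpow (by linarith)]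
  have hlogN : Real.log (1 - δ) + Real.log n ≤ Real.log N := by
    rw [← Real.log_mul (by linarith) (by linarith)]
    exact Real.log_le_log hpos hNn
  have hfac : Real.log N.factorial ≤
      sortingComplexity (intersectionOrder o) * Real.log 2 + N * Real.log J := by
    have h := (Nat.cast_le (α := ℝ)).2 (factorial_isolated_le b o)
    rw [← hN, ← hJ] at h
    push_cast at h
    have h' := Real.log_le_log (by positivity) h
    rwa [Real.log_mul (by positivity) (by positivity), Real.log_pow, Real.log_pow] at h'
  have hst := mul_log_sub_le_log_factorial (N := N) (by exact_mod_cast hN0)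
  -- `hlarge` makes the bracket nonnegative, so that `(1 - δ) * n` may be replaced by `N`.
  calc _ ≤ N * (γ * Real.log n - (1 + Real.log (2 * (k + 1)) - Real.log (1 - δ))) :=
        mul_le_mul_of_nonneg_right hNn (by linarith)
    _ ≤ N * (Real.log N - 1 - Real.log J) :=
        mul_le_mul_of_nonneg_left (by linarith) hN0.le
    _ ≤ _ := by linarith

/-- Markov's inequality for the number of pairs in a common cell. -/
theorem one_sub_le_prob_cellPairs_le {b : ℕ} (hb : 0 < b) (hbn : b ≤ n) {T : ℝ} (hT : 0 < T) :
    ENNReal.ofReal (1 - (n : ℝ) ^ 2 * (b / n : ℝ) ^ k / T) ≤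
      (randomTotalOrders k n).toOuterMeasure {o | ((cellPairs b o).card : ℝ) ≤ T} := by
  classical
  have hsum := sum_card_cellPairs_le (α := Fin n) (k := k) hb (by simpa using hbn)
  rw [Fintype.card_fin n] at hsum
  set E : ℝ := (n : ℝ) ^ 2 * (b / n : ℝ) ^ k
  have htot : (0 : ℝ) < Fintype.card (Fin k → TotalOrder (Fin n)) := by
    exact_mod_cast Fintype.card_pos
  have hbad : (({o | ¬ ((cellPairs b o).card : ℝ) ≤ T} :
      Finset (Fin k → TotalOrder (Fin n))).card : ℝ) * T ≤
      E * Fintype.card (Fin k → TotalOrder (Fin n)) := by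
    refine le_trans ?_ hsum
    rw [← nsmul_eq_mul]
    refine (Finset.card_nsmul_le_sum _ (fun o => ((cellPairs b o).card : ℝ)) T
      fun o ho => (not_le.1 (Finset.mem_filter.1 ho).2).le).trans ?_
    exact Finset.sum_le_sum_of_subset_of_nonneg (Finset.filter_subset _ _)
      fun _ _ _ => Nat.cast_nonneg _
  have hadd := Finset.card_filter_add_card_filter_not
    (s := (Finset.univ : Finset (Fin k → TotalOrder (Fin n))))
    (fun o => ((cellPairs b o).card : ℝ) ≤ T)
  rw [Finset.card_univ] at hadd
  have hadd' := congrArg (Nat.cast : ℕ → ℝ) hadd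
  push_cast at hadd'
  have hcard : Fintype.card {o : Fin k → TotalOrder (Fin n) | ((cellPairs b o).card : ℝ) ≤ T} =
      ({o | ((cellPairs b o).card : ℝ) ≤ T} : Finset (Fin k → TotalOrder (Fin n))).card := by
    rw [← Set.toFinset_card]
    congr 1
    ext o
    simp
  rw [randomTotalOrders, PMF.toOuterMeasure_uniformOfFintype_apply, hcard,
    ← ENNReal.ofReal_natCast, ← ENNReal.ofReal_natCast, ← ENNReal.ofReal_div_of_pos htot]
  refine ENNReal.ofReal_le_ofReal ?_
  rw [le_div_iff₀ htot, sub_mul, one_mul, div_mul_eq_mul_div]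
  have := (le_div_iff₀ hT).2 hbad
  linarith

theorem PMF.toOuterMeasure_le_one {β : Type*} (p : PMF β) (s : Set β) :
    p.toOuterMeasure s ≤ 1 := by
  rw [PMF.toOuterMeasure_apply]
  exact (ENNReal.tsum_le_tsum fun o => Set.indicator_le_self _ _ _).trans (PMF.tsum_coe _).le

theorem tendsto_prob_cellPairs {δ γ : ℝ} (hδ : 0 < δ) (hγ : 0 < γ) (hγ' : γ ≤ 1)
    (hk : 1 + (γ - 1) * k < 0) :
    Tendsto (fun n : ℕ => (randomTotalOrders k n).toOuterMeasure
      {o | ((cellPairs ⌈(n : ℝ) ^ γ⌉₊ o).card : ℝ) ≤ δ * n}) atTop (𝓝 1) := by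
  have hlim : Tendsto (fun n : ℕ => ENNReal.ofReal
      (1 - 2 ^ k / δ * (n : ℝ) ^ (1 + (γ - 1) * k))) atTop (𝓝 1) := by
    have h0 : Tendsto (fun n : ℕ => (n : ℝ) ^ (1 + (γ - 1) * k)) atTop (𝓝 0) := by
      have := (tendsto_rpow_neg_atTop (neg_pos.2 hk)).comp (tendsto_natCast_atTop_atTop (R := ℝ))
      simpa only [neg_neg, Function.comp_def] using this
    have := ENNReal.tendsto_ofReal ((h0.const_mul (2 ^ k / δ)).const_sub 1)
    simpa using this
  refine tendsto_of_tendsto_of_tendsto_of_le_of_le' hlim tendsto_const_nhds ?_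
    (Eventually.of_forall fun n => PMF.toOuterMeasure_le_one _ _)
  · filter_upwards [eventually_ge_atTop 1] with n hn
    have hn1 : (1 : ℝ) ≤ n := by exact_mod_cast hn
    have hn0 : (0 : ℝ) < n := by linarith
    have hp : (1 : ℝ) ≤ (n : ℝ) ^ γ := Real.one_le_rpow hn1 hγ.le
    have hb : 0 < ⌈(n : ℝ) ^ γ⌉₊ := Nat.ceil_pos.2 (by linarith)
    have hbn : ⌈(n : ℝ) ^ γ⌉₊ ≤ n := by
      rw [Nat.ceil_le]
      simpa using Real.rpow_le_rpow_of_exponent_le hn1 hγ'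
    refine le_trans (ENNReal.ofReal_le_ofReal ?_)
      (one_sub_le_prob_cellPairs_le hb hbn (mul_pos hδ hn0))
    -- Rounding up at most doubles `n ^ γ ≥ 1`; this is the source of `2 ^ k`.
    have hb2 : (⌈(n : ℝ) ^ γ⌉₊ : ℝ) / n ≤ 2 * (n : ℝ) ^ (γ - 1) := by
      rw [Real.rpow_sub hn0, Real.rpow_one, ← mul_div_assoc]
      refine div_le_div_of_nonneg_right ?_ hn0.le
      linarith [Nat.ceil_lt_add_one (show 0 ≤ (n : ℝ) ^ γ by linarith)]
    have hpow := pow_le_pow_left₀ (by positivity) hb2 k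
    have heq : (n : ℝ) ^ 2 * (2 * (n : ℝ) ^ (γ - 1)) ^ k / (δ * n) =
        2 ^ k / δ * (n : ℝ) ^ (1 + (γ - 1) * k) := by
      rw [Real.rpow_add hn0, Real.rpow_one, Real.rpow_mul hn0.le, Real.rpow_natCast, mul_pow]
      field_simp
    rw [← heq]
    gcongr

end Asymptotics

/-! ### A single order, and the choice of parameters -/

theorem sortingComplexity_eq_zero_of_total {α : Type*} (L : TotalOrder α) :
    sortingComplexity L.le = 0 := by
  refine Nat.le_zero.1 (sortingComplexity_le ⟨.leaf L, fun M hM => ⟨?_, le_rfl⟩⟩)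
  refine TotalOrder.ext_le fun x y => ⟨hM x y, fun h => ?_⟩
  rcases L.le_total' x y with h' | h'
  · exact h'
  · rw [M.le_antisymm' h (hM y x h')]
    exact L.le_rfl' y

theorem corollary5p5p3 (k : ℕ) (hk : 1 ≤ k) :
    ∀ ε : ℝ, 0 < ε →
      Tendsto
        (fun n : ℕ => (randomTotalOrders k n).toOuterMeasure
          {o | |(sortingComplexity (intersectionOrder o) : ℝ)
                - n * Real.log n / Real.log 2 * (1 - 1 / (k : ℝ))|
              ≤ ε * (n * Real.log n / Real.log 2 * (1 - 1 / (k : ℝ)))})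
        atTop (𝓝 1) := by
  intro ε hε
  obtain ⟨k, rfl⟩ : ∃ k', k = k' + 1 := ⟨k - 1, by omega⟩
  have hlog2 : 0 < Real.log 2 := Real.log_pos one_lt_two
  obtain rfl | hk0 := Nat.eq_zero_or_pos k
  · refine tendsto_const_nhds.congr fun n => ?_
    have huniv : {o : Fin (0 + 1) → TotalOrder (Fin n) |
        |(sortingComplexity (intersectionOrder o) : ℝ)
          - n * Real.log n / Real.log 2 * (1 - 1 / ((0 + 1 : ℕ) : ℝ))|
        ≤ ε * (n * Real.log n / Real.log 2 * (1 - 1 / ((0 + 1 : ℕ) : ℝ)))} = Set.univ := by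
      refine Set.eq_univ_of_forall fun o => ?_
      have h : intersectionOrder o = (o 0).le := by
        funext x y
        exact propext ⟨fun h => h 0, fun h i => by rwa [Fin.fin_one_eq_zero i]⟩
      simp [h, sortingComplexity_eq_zero_of_total]
    rw [huniv]
    exact ((PMF.toOuterMeasure_apply_eq_one_iff _ _).2 (Set.subset_univ _)).symm
  set c : ℝ := 1 - 1 / ((k + 1 : ℕ) : ℝ) with hc
  have hk1 : (1 : ℝ) ≤ k := by exact_mod_cast hk0
  have hkc : c * (k + 1) = k := by rw [hc]; push_cast; field_simp; ring
  have hc1 : c ≤ 1 := by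
    rw [hc]
    linarith [show (0 : ℝ) ≤ 1 / ((k + 1 : ℕ) : ℝ) by positivity]
  have hc2 : 1 / 2 ≤ c := by nlinarith
  -- `δ` is both the tolerated fraction of pairs in a common cell and the distance of `γ = c - δ`
  -- from the critical exponent `c`. The latter costs `k * δ` in the upper bound; the lower bound
  -- loses `2 * δ` in all.
  obtain ⟨δ, hδ0, hδ4, hkδ⟩ : ∃ δ : ℝ, 0 < δ ∧ δ ≤ 1 / 4 ∧ k * δ ≤ ε * c / 4 := by
    refine ⟨min (1 / 4) (ε * c / (4 * k)), by positivity, min_le_left _ _, ?_⟩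
    calc k * min (1 / 4) (ε * c / (4 * k)) ≤ k * (ε * c / (4 * k)) := by
          gcongr; exact min_le_right _ _
      _ = ε * c / 4 := by field_simp
  have hδε : δ ≤ ε * c / 4 := by nlinarith
  -- Since `c * (k + 1) = k`, the exponent `1 + (γ - 1) * (k + 1)` equals `-δ * (k + 1)`.
  have hlim := tendsto_prob_cellPairs (k := k + 1) hδ0 (γ := c - δ) (by linarith) (by linarith)
    (by push_cast; nlinarith)
  set K : ℝ := 1 + Real.log (2 * (k + 1)) - Real.log (1 - δ) with hK
  have hK0 : 0 ≤ K := by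
    have h1 : 0 ≤ Real.log (2 * (k + 1)) := Real.log_nonneg (by linarith)
    have h2 : Real.log (1 - δ) ≤ 0 := Real.log_nonpos (by linarith) (by linarith)
    linarith
  have hεc : 0 < ε * c := by positivity
  have hlog : Tendsto (fun n : ℕ => Real.log n) atTop atTop :=
    Real.tendsto_log_atTop.comp tendsto_natCast_atTop_atTop
  refine tendsto_of_tendsto_of_tendsto_of_le_of_le' hlim tendsto_const_nhds ?_
    (Eventually.of_forall fun n => PMF.toOuterMeasure_le_one _ _)
  -- The thresholds on `log n` give, in turn, `hlarge`, the absorption of `K` in the lower bound,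
  -- and that of the linear term `(2 * k + 1 + δ) * n` in the upper bound.
  · filter_upwards [eventually_ge_atTop 1, hlog.eventually_ge_atTop (K / (c - δ)),
      hlog.eventually_ge_atTop (K / (ε * c / 2)),
      hlog.eventually_ge_atTop ((2 * k + 1 + δ) * Real.log 2 / (ε * c / 2))] with n hn h1 h2 h3
    rw [div_le_iff₀ (by linarith)] at h1 h2 h3
    have hn1 : (1 : ℝ) ≤ n := by exact_mod_cast hn
    have hln : 0 ≤ Real.log n := Real.log_nonneg hn1
    refine (randomTotalOrders (k + 1) n).toOuterMeasure.mono fun o ho => ?_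
    have hup := sortingComplexity_upper hn (show c - δ ≤ 1 by linarith) o
    have hlo := sortingComplexity_lower hn (show c - δ ≤ 1 by linarith)
      (show δ < 1 by linarith) (by linarith) o ho
    change ((cellPairs _ o).card : ℝ) ≤ δ * n at ho
    rw [← hK] at hlo
    change |(sortingComplexity (intersectionOrder o) : ℝ) - n * Real.log n / Real.log 2 * c| ≤
      ε * (n * Real.log n / Real.log 2 * c)
    generalize (sortingComplexity (intersectionOrder o) : ℝ) = C at *
    obtain ⟨l, hl⟩ : ∃ l, Real.log n = l * Real.log 2 := ⟨_, (div_mul_cancel₀ _ hlog2.ne').symm⟩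
    have hdiv : Real.log n / Real.log 2 = l := by rw [hl]; field_simp
    rw [mul_div_assoc, hdiv]
    rw [hdiv] at hup
    rw [hl] at hlo h2 h3 hln
    have hl0 : 0 ≤ l := nonneg_of_mul_nonneg_left hln hlog2
    have h3' : 2 * k + 1 + δ ≤ l * (ε * c / 2) := by
      refine le_of_mul_le_mul_right ?_ hlog2
      linarith
    rw [abs_le]
    constructor
    · have hγ : (c - 2 * δ) * (l * Real.log 2) - K ≤
          (1 - δ) * ((c - δ) * (l * Real.log 2) - K) := by
        nlinarith [mul_nonneg hδ0.le hK0, mul_nonneg (mul_nonneg hδ0.le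
          (show 0 ≤ 1 - c + δ by linarith)) hln]
      have hlow : (1 - ε) * c * (l * Real.log 2) ≤
          (1 - δ) * ((c - δ) * (l * Real.log 2) - K) := by
        nlinarith [mul_nonneg (show 0 ≤ ε * c / 2 - 2 * δ by linarith) hln]
      have h4 := mul_le_mul_of_nonneg_left hlow (show (0 : ℝ) ≤ n by linarith)
      refine le_of_mul_le_mul_right ?_ hlog2
      linarith
    · have hk' : k * (2 + (1 - (c - δ)) * l) + 1 + δ ≤ (1 + ε) * c * l := by
        -- This identity makes the leading terms of the two bounds agree.
        have : (k : ℝ) * (1 - c) = c := by linarith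
        nlinarith [mul_nonneg (show 0 ≤ ε * c / 2 - k * δ by linarith) hl0]
      have h4 := mul_le_mul_of_nonneg_left hk' (show (0 : ℝ) ≤ n by linarith)
      linarith
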